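/- Let $X$ be a regular $T_1$ topological space. **Games.** For collections of sets $\mathcal A,\mathcal B$, in the game $\mathsf G_1(\mathcal A,\mathcal B)$ in each round $n\in\omega$ One chooses $A_n\in\mathcal A$ and Two responds with $x_n\in A_n$; Two wins if $\{x_n:n\in\omega\}\in\mathcal B$, and One wins otherwise. $\mathrm I\uparrow\mathsf G_1(\mathcal A,\mathcal B)$ (resp. $\mathrm{II}\uparrow\mathsf G_1(\mathcal A,\mathcal B)$) means that One (resp. Two) has a winning strategy that may use all previous moves of the opponent (for Two, including the current one). $\neg\mathcal B$ is the collection of all sets not in $\mathcal B$. **Families.** For a space $Z$ and $z\in Z$: $\mathscr T_Z$ is the set of proper non-empty open subsets of $Z$, $\mathscr D_Z$ the set of dense subsets, $\mathrm{CD}_Z$ the set of closed discrete subsets, and $\Omega_{Z,z}=\{A\subseteq Z: z\in\operatorname{cl}(A)\}$. Let $[X]^{<\omega}$ be the set of non-empty finite subsets of $X$ and $K(X)$ the set of non-empty compact subsets of $X$. For $\mathcal A\in\{[X]^{<\omega},K(X)\}$: $\mathscr N_X[\mathcal A]=\{\mathscr N_X(A):A\in\mathcal A\}$, where $\mathscr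 N_X(A)=\{U\in\mathscr T_X:A\subseteq U\}$; an $\mathcal A$-cover is an open cover $\mathscr U$ of $X$ with $\emptyset,X\notin\mathscr U$ such that every $A\in\mathcal A$ is contained in some $U\in\mathscr U$; $\mathcal O_X(\mathcal A)$ is the set of all $\mathcal A$-covers; and $\Gamma_X(\mathcal A)$ is the set of countable $\mathcal A$-covers $\mathscr U$ such that every $A\in\mathcal A$ is contained in all but finitely many members of $\mathscr U$. Write $\Omega_X=\mathcal O_X([X]^{<\omega})$, $\mathcal K_X=\mathcal O_X(K(X))$, $\Gamma_\omega(X)=\Gamma_X([X]^{<\omega})$, $\Gamma_k(X)=\Gamma_X(K(X))$. **Minimal usco maps.** A map $\Phi$ assigning to each $x\in X$ a non-empty compact set $\Phi(x)\subseteq\mathbb R$ is usco if $\{x:\Phi(x)\subseteq V\}$ is open for every open $V\subseteq\mathbb R$; it is minimal usco if moreover its graph is minimal under inclusion among graphs of usco maps. $MU_{\mathcal A}(X)$ is the set of minimal usco maps with the topology of the uniformity generated by the sets $$\mathbf W(A,\varepsilon)=\{\langle\Phi,\Psi\rangle:(\forall x\in A)\ \Phi(x)\subseteq\mathbb B(\Psi(x),\varepsilon)\text{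 and }\Psi(x)\subseteq\mathbb B(\Phi(x),\varepsilon)\},\qquad A\in\mathcal A,\ \varepsilon>0,$$ where $\mathbb B(S,\varepsilon)=\bigcup_{y\in S}(y-\varepsilon,y+\varepsilon)$. $MU_p(X)$ is the case $\mathcal A=[X]^{<\omega}$, $MU_k(X)$ the case $\mathcal A=K(X)$, and $\mathbf 0$ is the map with constant value $\{0\}$. **Claim.** If $X$ is infinite, the following are equivalent: 1. $\mathrm{II}\uparrow\mathsf G_1(\Omega_X,\Omega_X)$; 2. $\mathrm{II}\uparrow\mathsf G_1(\Omega_{MU_p(X),\mathbf 0},\Omega_{MU_p(X),\mathbf 0})$; 3. $\mathrm{II}\uparrow\mathsf G_1(\mathscr D_{MU_p(X)},\Omega_{MU_p(X),\mathbf 0})$; 4. $\mathrm I\uparrow\mathsf G_1(\mathscr T_{MU_p(X)},\mathrm{CD}_{MU_p(X)})$; 5. $\mathrm I\uparrow\mathsf G_1(\mathscr N_X[[X]^{<\omega}],\neg\Omega_X)$; 6. $\mathrm I\uparrow\mathsf G_1(\mathscr N_X[[X]^{<\omega}],\neg\Gamma_\omega(X))$. If $X$ is not compact, the following are equivalent: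 1. $\mathrm{II}\uparrow\mathsf G_1(\mathcal K_X,\mathcal K_X)$; 2. $\mathrm{II}\uparrow\mathsf G_1(\Omega_{MU_k(X),\mathbf 0},\Omega_{MU_k(X),\mathbf 0})$; 3. $\mathrm{II}\uparrow\mathsf G_1(\mathscr D_{MU_k(X)},\Omega_{MU_k(X),\mathbf 0})$; 4. $\mathrm I\uparrow\mathsf G_1(\mathscr T_{MU_k(X)},\mathrm{CD}_{MU_k(X)})$; 5. $\mathrm I\uparrow\mathsf G_1(\mathscr N_X[K(X)],\neg\mathcal K_X)$; 6. $\mathrm I\uparrow\mathsf G_1(\mathscr N_X[K(X)],\neg\Gamma_k(X))$. -/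

import Mathlib

open Set Filter Topology

namespace UscoGame

/-! ### Single-selection games of length `ω`

In the game `G₁(𝒜, ℬ)`, in round `n` One plays `A n ∈ 𝒜` and Two answers with `x n ∈ A n`;
Two wins if `{x n : n ∈ ω} ∈ ℬ`, otherwise One wins. -/

section Games

variable {α : Type*}

/-- One has a winning (full information) strategy in `G₁(𝒜, ℬ)`: a function from the finite
sequences of `⋃ 𝒜` to `𝒜` such that One wins every play in which One follows it. -/
def OneWins (𝒜 ℬ : Set (Set α)) : Prop :=
  ∃ σ : List ↥(⋃₀ 𝒜) → ↥𝒜, ∀ x : ℕ → ↥(⋃₀ 𝒜),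
    (∀ n, (x n : α) ∈ (σ ((List.range n).map x) : Set α)) →
      range (fun n => (x n : α)) ∉ ℬ

/-- Two has a winning (full information) strategy in `G₁(𝒜, ℬ)`: a function from the finite
sequences of `𝒜` to `⋃ 𝒜` whose answers are legal moves and which wins against every sequence of
moves of One. -/
def TwoWins (𝒜 ℬ : Set (Set α)) : Prop :=
  ∃ τ : List ↥𝒜 → ↥(⋃₀ 𝒜), ∀ A : ℕ → ↥𝒜,
    (∀ n, (τ ((List.range (n + 1)).map A) : α) ∈ (A n : Set α)) ∧
      range (fun n => (τ ((List.range (n + 1)).map A) : α)) ∈ ℬ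

end Games

/-! ### Families attached to a topological space -/

section Families

variable (X : Type*) [TopologicalSpace X]

/-- `[X]^{<ω}`, as an ideal of sets: the non-empty finite subsets of `X`. -/
def finiteIdeal (X : Type*) : Set (Set X) := {F | F.Finite ∧ F.Nonempty}

/-- `K(X)`: the non-empty compact subsets of `X`. -/
def compactIdeal : Set (Set X) := {K | IsCompact K ∧ K.Nonempty}

/-- `𝒯_X`: the proper non-empty open subsets of `X`. -/
def properOpens : Set (Set X) := {U | IsOpen U ∧ U.Nonempty ∧ U ≠ univ}

/-- `𝒟_X`: the dense subsets of `X`. -/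
def denseSets : Set (Set X) := {D | Dense D}

/-- `CD_X`: the closed discrete subsets of `X`. -/
def closedDiscreteSets : Set (Set X) := {D | IsClosed D ∧ DiscreteTopology D}

variable {X}

/-- `Ω_{X,x}`: the subsets of `X` having `x` in their closure. -/
def clusterSets (x : X) : Set (Set X) := {A | x ∈ closure A}

/-- `𝒩_X(A)`: the proper open subsets of `X` that contain the (non-empty) set `A`. -/
def openNhds (A : Set X) : Set (Set X) := {U | U ∈ properOpens X ∧ A ⊆ U}

/-- `𝒩_X[𝒜] = {𝒩_X(A) : A ∈ 𝒜}`. -/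
def openNhdsFamilies (𝒜 : Set (Set X)) : Set (Set (Set X)) := openNhds '' 𝒜

/-- `𝒪_X`: the non-trivial open covers of `X`. -/
def openCovers (X : Type*) [TopologicalSpace X] : Set (Set (Set X)) :=
  {𝒰 | (∀ U ∈ 𝒰, IsOpen U) ∧ ⋃₀ 𝒰 = univ ∧ ∅ ∉ 𝒰 ∧ univ ∉ 𝒰}

/-- `𝒪_X(𝒜)`: the `𝒜`-covers of `X`. For the finite sets these are the `ω`-covers, for the
compact sets the `k`-covers. -/
def idealCovers (𝒜 : Set (Set X)) : Set (Set (Set X)) :=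
  {𝒰 | 𝒰 ∈ openCovers X ∧ ∀ A ∈ 𝒜, ∃ U ∈ 𝒰, A ⊆ U}

/-- `Γ_X(𝒜)`: the countable `𝒜`-covers `𝒰` such that every `A ∈ 𝒜` is contained in all but
finitely many members of `𝒰`. -/
def gammaCovers (𝒜 : Set (Set X)) : Set (Set (Set X)) :=
  {𝒰 | 𝒰 ∈ idealCovers 𝒜 ∧ 𝒰.Countable ∧ ∀ A ∈ 𝒜, {U ∈ 𝒰 | ¬ A ⊆ U}.Finite}

end Families

/-! ### Minimal usco maps -/

section Usco

variable {X Y : Type*} [TopologicalSpace X] [TopologicalSpace Y]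

/-- An usco map: an upper semicontinuous set-valued map with non-empty compact values. -/
def IsUsco (Φ : X → Set Y) : Prop :=
  (∀ x, (Φ x).Nonempty ∧ IsCompact (Φ x)) ∧ ∀ V : Set Y, IsOpen V → IsOpen {x | Φ x ⊆ V}

/-- The graph of a set-valued map. -/
def setGraph (Φ : X → Set Y) : Set (X × Y) := {p | p.2 ∈ Φ p.1}

/-- A minimal usco map: an usco map whose graph is minimal, with respect to inclusion, among the
graphs of usco maps. -/
def IsMinimalUsco (Φ : X → Set Y) : Prop :=
  IsUsco Φ ∧ ∀ Ψ : X → Set Y, IsUsco Ψ → setGraph Ψ ⊆ setGraph Φ → setGraph Ψ = setGraph Φ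

end Usco

section MU

variable {X : Type*} [TopologicalSpace X]

/-- The set of minimal usco maps from `X` to `ℝ`. The family `𝒜` plays no role for the
set; it determines the topology given below, that of uniform convergence on the members of `𝒜`. -/
def MU (_𝒜 : Set (Set X)) : Type _ := {Φ : X → Set ℝ // IsMinimalUsco Φ}

/-- `W(A, ε)`: the pairs `(Φ, Ψ)` such that, for every `x ∈ A`, each of `Φ x`, `Ψ x` is
contained in the open `ε`-neighbourhood of the other. -/
def MU.entourage (𝒜 : Set (Set X)) (A : Set X) (ε : ℝ) : Set (MU 𝒜 × MU 𝒜) :=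
  {p | ∀ x ∈ A, p.1.1 x ⊆ ⋃ y ∈ p.2.1 x, Metric.ball y ε ∧
    p.2.1 x ⊆ ⋃ y ∈ p.1.1 x, Metric.ball y ε}

/-- The uniformity generated by the sets `W(A, ε)` for `A ∈ 𝒜` and `ε > 0`. -/
def MU.uniformCore (𝒜 : Set (Set X)) : UniformSpace.Core (MU 𝒜) where
  uniformity := ⨅ A ∈ 𝒜, ⨅ ε > (0 : ℝ), 𝓟 (MU.entourage 𝒜 A ε)
  refl := by
    refine le_iInf₂ fun A _ => le_iInf₂ fun ε hε => principal_mono.2 ?_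
    rintro ⟨Φ, Ψ⟩ h
    obtain rfl : Φ = Ψ := h
    intro x _
    exact ⟨fun y hy => mem_iUnion₂.2 ⟨y, hy, Metric.mem_ball_self hε⟩,
      fun y hy => mem_iUnion₂.2 ⟨y, hy, Metric.mem_ball_self hε⟩⟩
  symm := by
    refine tendsto_iInf.2 fun A => tendsto_iInf.2 fun hA => tendsto_iInf.2 fun ε =>
      tendsto_iInf.2 fun hε => ?_
    refine tendsto_principal.2 (mem_iInf_of_mem A (mem_iInf_of_mem hA (mem_iInf_of_mem ε
      (mem_iInf_of_mem hε ?_))))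
    exact fun p hp x hx => ⟨(hp x hx).2, (hp x hx).1⟩
  comp := by
    refine le_iInf₂ fun A hA => le_iInf₂ fun ε hε => le_principal_iff.2 ?_
    have hmem : MU.entourage 𝒜 A (ε / 2) ∈
        ⨅ A ∈ 𝒜, ⨅ ε > (0 : ℝ), 𝓟 (MU.entourage 𝒜 A ε) :=
      mem_iInf_of_mem A (mem_iInf_of_mem hA (mem_iInf_of_mem (ε / 2)
        (mem_iInf_of_mem (half_pos hε) (mem_principal_self _))))
    refine mem_of_superset (mem_lift' hmem) ?_
    rintro ⟨Φ, Θ⟩ ⟨Ψ, h₁, h₂⟩ x hx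
    have key : ∀ P Q R : Set ℝ, (P ⊆ ⋃ y ∈ Q, Metric.ball y (ε / 2)) →
        (Q ⊆ ⋃ y ∈ R, Metric.ball y (ε / 2)) → P ⊆ ⋃ y ∈ R, Metric.ball y ε := by
      intro P Q R hPQ hQR p hp
      obtain ⟨q, hq, hpq⟩ := mem_iUnion₂.1 (hPQ hp)
      obtain ⟨r, hr, hqr⟩ := mem_iUnion₂.1 (hQR hq)
      refine mem_iUnion₂.2 ⟨r, hr, ?_⟩
      rw [Metric.mem_ball] at *
      linarith [dist_triangle p q r]
    exact ⟨key _ _ _ (h₁ x hx).1 (h₂ x hx).1, key _ _ _ (h₂ x hx).2 (h₁ x hx).2⟩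

/-- `MU_𝒜(X)`: the minimal usco maps with the topology of uniform convergence on the
members of `𝒜`. -/
instance (𝒜 : Set (Set X)) : UniformSpace (MU 𝒜) := UniformSpace.ofCore (MU.uniformCore 𝒜)

/-- `𝟎`: the set-valued map that is constantly `{0}`. -/
def MU.zero (𝒜 : Set (Set X)) : MU 𝒜 :=
  ⟨fun _ => {0}, ⟨fun _ => ⟨singleton_nonempty 0, isCompact_singleton⟩, fun V _ => by simp⟩, by
    intro Ψ hΨ h
    refine h.antisymm ?_
    rintro ⟨x, y⟩ hy
    obtain ⟨z, hz⟩ := (hΨ.1 x).1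
    have h0 : z = 0 := h (show (x, z) ∈ setGraph Ψ from hz)
    have h1 : y = 0 := hy
    subst h0 h1
    exact hz⟩

variable (X)

/-- `MU_p(X)`: minimal usco maps with the topology of pointwise convergence. -/
abbrev MUp : Type _ := MU (finiteIdeal X)

/-- `MU_k(X)`: minimal usco maps with the topology of uniform convergence on compact sets. -/
abbrev MUk : Type _ := MU (compactIdeal X)

end MU

end UscoGame

open UscoGame

/-! Everything passes through one game: One names `A ∈ 𝒜` and Two answers with a proper open `U ⊇
A`. Call `Cov` the assertion that One can force every member of `𝒜` into some answer, and `Ev` that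
One can force it into almost all answers. Each condition yields `Cov`, `Cov` gives `Ev`, and `Ev`
gives each condition back. Two's strategies become One's by duality (`TwoWins.oneForces`,
`OneForces.twoWins`): after any history, the answers available to a strategy of Two include a whole
move `M i`, provided every selection from the sets `M i` is a legal move of One in Two's game. Two
translations connect the games on `X` and on `MU 𝒜`. A map `Φ` gives the open set where `Φ x` lies
in the ball of radius `1 / (n + 1)`, so `Ev` forces convergence to `𝟎` (`OneForces.tendsto_zero`).
An answer `U` to `A` gives a minimal usco map unchanged near `A` and equal to `{n + 1}` off `U`
(`OneForces.forces_cover`). Were some `A` never covered, the `n`-th map would take the value `n + 1`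
on `A` for every `n`; such maps stay away from `𝟎` and form a closed discrete set, since usco maps
are bounded on compact sets. -/

namespace UscoGame

/-! ### Translating and dualizing strategies -/

section Strategies

variable {α β ι κ : Type*}

/-- One, whose moves are the sets `M i`, can force the sequence of Two's answers to satisfy `P`. -/
def OneForces (M : ι → Set α) (P : (ℕ → α) → Prop) : Prop :=
  ∃ σ : List α → ι, ∀ x : ℕ → α, (∀ n, x n ∈ M (σ ((List.range n).map x))) → P x

theorem OneForces.oneWins {𝒜 ℬ : Set (Set α)} {M : ι → Set α} {P : (ℕ → α) → Prop}
    (h : OneForces M P) (hM : ∀ i, M i ∈ 𝒜)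
    (hP : ∀ x : ℕ → α, (∀ n, ∃ i, x n ∈ M i) → P x → range x ∉ ℬ) : OneWins 𝒜 ℬ := by
  obtain ⟨σ, hσ⟩ := h
  refine ⟨fun l => ⟨M (σ (l.map Subtype.val)), hM _⟩, fun x hx => ?_⟩
  simp only [List.map_map] at hx
  exact hP _ (fun n => ⟨_, hx n⟩) (hσ _ hx)

theorem OneWins.oneForces {𝒜 ℬ : Set (Set α)} (h : OneWins 𝒜 ℬ) :
    OneForces (fun A : 𝒜 => (A : Set α)) (fun x => range x ∉ ℬ) := by
  classical
  obtain ⟨σ, hσ⟩ := h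
  refine ⟨fun l => σ (l.filterMap fun a => if h : a ∈ ⋃₀ 𝒜 then some ⟨a, h⟩ else none),
    fun x hx => ?_⟩
  have hmem : ∀ n, x n ∈ ⋃₀ 𝒜 := fun n => ⟨_, Subtype.coe_prop _, hx n⟩
  refine hσ (fun n => ⟨x n, hmem n⟩) fun n => ?_
  have key : ((List.range n).map x).filterMap
      (fun a => if h : a ∈ ⋃₀ 𝒜 then some (⟨a, h⟩ : ↥(⋃₀ 𝒜)) else none) =
      (List.range n).map fun n => ⟨x n, hmem n⟩ := by
    rw [List.filterMap_map, ← List.filterMap_eq_map]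
    congr 1
    funext k
    simp only [Function.comp, dif_pos (hmem k)]
  have := hx n
  dsimp only at this
  rwa [key] at this

/-- A strategy can be transferred to another game by translating One's moves forwards and Two's
answers backwards. -/
theorem OneForces.transfer {M : ι → Set α} {P : (ℕ → α) → Prop} {N : κ → Set β}
    {Q : (ℕ → β) → Prop} (h : OneForces M P) (f : ℕ → ι → κ) (g : ℕ → ι → β → α)
    (hg : ∀ n i, ∀ b ∈ N (f n i), g n i b ∈ M i)
    (hPQ : ∀ (i : ℕ → ι) (b : ℕ → β), (∀ n, b n ∈ N (f n (i n))) →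
      P (fun n => g n (i n) (b n)) → Q b) : OneForces N Q := by
  obtain ⟨σ, hσ⟩ := h
  -- `T` rebuilds the simulated history from Two's actual answers; its length is the round number.
  let T : List β → List α := List.foldl (fun acc b => acc ++ [g acc.length (σ acc) b]) []
  refine ⟨fun l => f l.length (σ (T l)), fun b hb => ?_⟩
  let i : ℕ → ι := fun n => σ (T ((List.range n).map b))
  have hT : ∀ n, T ((List.range n).map b) = (List.range n).map fun n => g n (i n) (b n) := by
    intro n
    induction n with
    | zero => rfl
    | succ n ih =>
      have h1 : T ((List.range (n + 1)).map b) = T ((List.range n).map b) ++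
          [g (T ((List.range n).map b)).length (i n) (b n)] := by
        simp only [T, i, List.range_succ, List.map_append, List.foldl_append, List.map_cons,
          List.map_nil, List.foldl_cons, List.foldl_nil]
      rw [h1, List.range_succ, List.map_append, ih]
      simp
  have hb' : ∀ n, b n ∈ N (f n (i n)) := fun n => by simpa using hb n
  refine hPQ i b hb' (hσ _ fun n => ?_)
  rw [← hT n]
  exact hg n (i n) (b n) (hb' n)

theorem OneForces.mono {M : ι → Set α} {P Q : (ℕ → α) → Prop} (h : OneForces M P)
    (hPQ : ∀ x, (∀ n, ∃ i, x n ∈ M i) → P x → Q x) : OneForces M Q := by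
  obtain ⟨σ, hσ⟩ := h
  exact ⟨σ, fun x hx => hPQ x (fun n => ⟨_, hx n⟩) (hσ x hx)⟩

theorem OneForces.twoWins {𝒟 ℬ : Set (Set α)} {M : ι → Set α}
    (h : OneForces M fun x => range x ∈ ℬ) (h𝒟 : (⋃₀ 𝒟).Nonempty)
    (hM : ∀ i, ∀ D ∈ 𝒟, (M i ∩ D).Nonempty) : TwoWins 𝒟 ℬ := by
  obtain ⟨σ, hσ⟩ := h
  obtain ⟨x₀, hx₀⟩ := h𝒟
  choose c hcM hcD using fun (i : ι) (D : 𝒟) => hM i D D.2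
  let T : List 𝒟 → List α := List.foldl (fun acc D => acc ++ [c (σ acc) D]) []
  have hTmem : ∀ (l : List 𝒟) (l' : List α), (∀ a ∈ l', a ∈ ⋃₀ 𝒟) →
      ∀ a ∈ l.foldl (fun acc D => acc ++ [c (σ acc) D]) l', a ∈ ⋃₀ 𝒟 := by
    intro l
    induction l with
    | nil => exact fun l' h => h
    | cons D l ih =>
      intro l' h
      refine ih _ fun a ha => ?_
      rcases List.mem_append.1 ha with ha | ha
      · exact h a ha
      · rw [List.mem_singleton.1 ha]
        exact ⟨D, D.2, hcD _ _⟩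
  -- The default `x₀` is reached only on the empty history, where a strategy must still return a
  -- point of `⋃₀ 𝒟`.
  have hlast : ∀ l, (T l).getLastD x₀ ∈ ⋃₀ 𝒟 := by
    intro l
    rcases List.eq_nil_or_concat (T l) with h | ⟨L, b, h⟩
    · rw [h]; exact hx₀
    · have : b ∈ T l := by simp [h]
      have := hTmem l [] (by simp) b this
      simpa [h] using this
  refine ⟨fun l => ⟨_, hlast l⟩, fun A => ?_⟩
  let x : ℕ → α := fun n => c (σ (T ((List.range n).map A))) (A n)
  have hs : ∀ n, T ((List.range (n + 1)).map A) = T ((List.range n).map A) ++ [x n] := by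
    intro n
    simp only [T, x, List.range_succ, List.map_append, List.foldl_append, List.map_cons,
      List.map_nil, List.foldl_cons, List.foldl_nil]
  have hT : ∀ n, T ((List.range n).map A) = (List.range n).map x := by
    intro n
    induction n with
    | zero => rfl
    | succ n ih => rw [hs, ih, List.range_succ, List.map_append]; simp
  have hx : ∀ n, (T ((List.range (n + 1)).map A)).getLastD x₀ = x n := fun n => by
    rw [hs]; simp
  simp only [hx]
  refine ⟨fun n => hcD _ _, hσ x fun n => ?_⟩
  rw [← hT n]
  exact hcM _ _

/-- If after a history `s` no `M i` consisted entirely of possible answers of `τ`, choosing a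
non-answer from each `M i` would give a set in `𝒟`, and the answer of `τ` to that set would be one
of the non-answers. So One plays such an `M i` and reads each reply as an answer of `τ`. -/
theorem TwoWins.oneForces {𝒟 ℬ : Set (Set α)} {M : ι → Set α} (h : TwoWins 𝒟 ℬ)
    (hM : ∀ c : ι → α, (∀ i, c i ∈ M i) → range c ∈ 𝒟) :
    OneForces M fun x => range x ∈ ℬ := by
  obtain ⟨τ, hτ⟩ := h
  have hlegal : ∀ (s : List 𝒟) (D : 𝒟), (τ (s ++ [D]) : α) ∈ (D : Set α) := by
    intro s D
    -- `hτ` speaks of infinite plays only, so the finite history is prolonged by repeating `D`.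
    have := (hτ fun k => (s ++ [D]).getD k D).1 s.length
    have hl : (List.range (s.length + 1)).map (fun k => (s ++ [D]).getD k D) = s ++ [D] := by
      refine List.ext_getElem (by simp) fun k h1 h2 => ?_
      simp [List.getD_eq_getElem?_getD, List.getElem?_eq_getElem h2]
    rw [hl] at this
    simpa using this
  have hne : Nonempty 𝒟 := by
    obtain ⟨D, hD, -⟩ := (τ []).2
    exact ⟨⟨D, hD⟩⟩
  have key : ∀ s : List 𝒟, ∃ i, ∀ a, ∃ D : 𝒟, a ∈ M i → (τ (s ++ [D]) : α) = a := by
    intro s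
    by_contra! hcon
    choose c hc using hcon
    have hD := hM c fun i => (hc i hne.some).1
    obtain ⟨i, hi⟩ := hlegal s ⟨_, hD⟩
    exact (hc i ⟨_, hD⟩).2 hi.symm
  choose i D hD using key
  let T : List α → List 𝒟 := List.foldl (fun acc a => acc ++ [D acc a]) []
  refine ⟨fun l => i (T l), fun x hx => ?_⟩
  let A : ℕ → 𝒟 := fun n => D (T ((List.range n).map x)) (x n)
  have hs : ∀ n, T ((List.range (n + 1)).map x) = T ((List.range n).map x) ++ [A n] := by
    intro n
    simp only [T, A, List.range_succ, List.map_append, List.foldl_append, List.map_cons,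
      List.map_nil, List.foldl_cons, List.foldl_nil]
  have hT : ∀ n, T ((List.range n).map x) = (List.range n).map A := by
    intro n
    induction n with
    | zero => rfl
    | succ n ih => rw [hs, ih, List.range_succ, List.map_append]; simp
  have hx' : ∀ n, (τ ((List.range (n + 1)).map A) : α) = x n := by
    intro n
    rw [← hT, hs]
    exact hD _ _ (hx n)
  have := (hτ A).2
  simpa only [hx'] using this

end Strategies

/-! ### From covering once to covering almost always -/

section Covers

variable {X : Type*} [TopologicalSpace X]

/-- If One can force every member of `𝒜` to be covered by an answer, One can force it to be
covered by almost all answers. -/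
theorem OneForces.eventually_subset {𝒜 : Set (Set X)} (hU : ∀ A ∈ 𝒜, ∀ B ∈ 𝒜, A ∪ B ∈ 𝒜)
    (h : OneForces (fun A : 𝒜 => openNhds (A : Set X)) fun U => ∀ A ∈ 𝒜, ∃ n, A ⊆ U n) :
    OneForces (fun A : 𝒜 => openNhds (A : Set X)) fun U => ∀ A ∈ 𝒜, ∀ᶠ n in atTop, A ⊆ U n := by
  obtain ⟨σ, hσ⟩ := h
  have hbig : ∀ L : List (List (Set X)), ∃ B : 𝒜, ∀ t ∈ L, (σ t : Set X) ⊆ B := by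
    intro L
    induction L with
    | nil => exact ⟨σ [], by simp⟩
    | cons t L ih =>
      obtain ⟨B, hB⟩ := ih
      refine ⟨⟨σ t ∪ B, hU _ (σ t).2 _ B.2⟩, fun s hs => ?_⟩
      rcases List.mem_cons.1 hs with rfl | hs
      · exact subset_union_left
      · exact (hB s hs).trans subset_union_right
  choose B hB using hbig
  -- One answers a history with a set containing the replies of `σ` to all its sublists. Every
  -- subsequence of the play is then itself a legal play against `σ`, so no `A` can be missed
  -- infinitely often.
  refine ⟨fun l => B l.sublists, fun U hUB A hA => ?_⟩
  by_contra hcon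
  obtain ⟨φ, hφ, hφA⟩ := extraction_of_frequently_atTop (not_eventually.1 hcon)
  have hsub : ∀ k, ((List.range k).map φ).Sublist (List.range (φ k)) := by
    intro k
    induction k with
    | zero => simp
    | succ k ih =>
      rw [List.range_succ, List.map_append]
      have h1 : ((List.range k).map φ ++ [φ k]).Sublist (List.range (φ k + 1)) := by
        rw [List.range_succ]
        exact ih.append (List.Sublist.refl _)
      exact h1.trans (List.range_sublist.2 (hφ k.lt_succ_self))
  obtain ⟨k, hk⟩ := hσ (U ∘ φ) (fun k => by
    refine ⟨(hUB (φ k)).1, Subset.trans ?_ (hUB (φ k)).2⟩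
    refine hB _ _ (List.mem_sublists.2 ?_)
    rw [← List.map_map]
    exact (hsub k).map U) A hA
  exact hφA k hk

theorem range_mem_idealCovers {ι : Type*} {𝒜 : Set (Set X)} (h1 : ∀ x, {x} ∈ 𝒜) {U : ι → Set X}
    (hU : ∀ n, U n ∈ properOpens X) (h : ∀ A ∈ 𝒜, ∃ n, A ⊆ U n) :
    range U ∈ idealCovers 𝒜 := by
  refine ⟨⟨?_, ?_, ?_, ?_⟩, ?_⟩
  · rintro _ ⟨n, rfl⟩
    exact (hU n).1
  · refine eq_univ_of_forall fun x => ?_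
    obtain ⟨n, hn⟩ := h _ (h1 x)
    exact ⟨_, ⟨n, rfl⟩, hn rfl⟩
  · rintro ⟨n, hn⟩
    exact (hU n).2.1.ne_empty hn
  · rintro ⟨n, hn⟩
    exact (hU n).2.2 hn
  · intro A hA
    obtain ⟨n, hn⟩ := h A hA
    exact ⟨_, ⟨n, rfl⟩, hn⟩

end Covers

/-! ### Constructing minimal usco maps -/

section UscoMaps

variable {X Y : Type*} [TopologicalSpace X] [TopologicalSpace Y]

/-- Zorn's lemma for reversed inclusion: by compactness, the pointwise intersection of a chain has
non-empty values and stays upper semicontinuous. -/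
theorem IsUsco.exists_isMinimalUsco [T2Space Y] {Θ : X → Set Y} (hΘ : IsUsco Θ) :
    ∃ Φ : X → Set Y, IsMinimalUsco Φ ∧ ∀ x, Φ x ⊆ Θ x := by
  have hzorn : ∀ c ⊆ {Φ : (X → Set Y)ᵒᵈ | IsUsco (OrderDual.ofDual Φ)},
      IsChain (· ≤ ·) c → ∀ y ∈ c,
        ∃ ub ∈ {Φ : (X → Set Y)ᵒᵈ | IsUsco (OrderDual.ofDual Φ)}, ∀ z ∈ c, z ≤ ub := by
    intro c hc hchain Φ₀ hΦ₀
    have : Nonempty c := ⟨⟨Φ₀, hΦ₀⟩⟩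
    have hdir : ∀ x, Directed (· ⊇ ·) fun Φ : c => OrderDual.ofDual Φ.1 x := by
      intro x Φ Ψ
      rcases hchain.total Φ.2 Ψ.2 with h | h
      · exact ⟨Ψ, h x, subset_rfl⟩
      · exact ⟨Φ, subset_rfl, h x⟩
    refine ⟨OrderDual.toDual fun x => ⋂ Φ : c, OrderDual.ofDual Φ.1 x, ⟨fun x => ⟨?_, ?_⟩, ?_⟩,
      fun Φ hΦ x => iInter_subset (fun Φ : c => OrderDual.ofDual Φ.1 x) ⟨Φ, hΦ⟩⟩
    · exact IsCompact.nonempty_iInter_of_directed_nonempty_isCompact_isClosed _ (hdir x)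
        (fun Φ => ((hc Φ.2).1 x).1) (fun Φ => ((hc Φ.2).1 x).2)
        (fun Φ => ((hc Φ.2).1 x).2.isClosed)
    · exact ((hc hΦ₀).1 x).2.of_isClosed_subset
        (isClosed_iInter fun Φ => ((hc Φ.2).1 x).2.isClosed)
        (iInter_subset (fun Φ : c => OrderDual.ofDual Φ.1 x) ⟨Φ₀, hΦ₀⟩)
    · intro V hV
      have : {x | ⋂ Φ : c, OrderDual.ofDual Φ.1 x ⊆ V} =
          ⋃ Φ : c, {x | OrderDual.ofDual Φ.1 x ⊆ V} := by
        ext x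
        simp only [mem_ofPred_eq, mem_iUnion]
        constructor
        · intro h
          exact exists_subset_nhds_of_isCompact' (hdir x) (fun Φ => ((hc Φ.2).1 x).2)
            (fun Φ => ((hc Φ.2).1 x).2.isClosed) fun y hy => hV.mem_nhds (h hy)
        · rintro ⟨Φ, hΦ⟩
          exact (iInter_subset _ Φ).trans hΦ
      change IsOpen {x | ⋂ Φ : c, OrderDual.ofDual Φ.1 x ⊆ V}
      rw [this]
      exact isOpen_iUnion fun Φ => (hc Φ.2).2 V hV
  obtain ⟨Φ, hΘΦ, hΦ⟩ := zorn_le_nonempty₀ _ hzorn (OrderDual.toDual Θ) hΘ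
  refine ⟨OrderDual.ofDual Φ, ⟨hΦ.1, fun Ψ hΨ h => ?_⟩, hΘΦ⟩
  have h' : ∀ x, Ψ x ⊆ OrderDual.ofDual Φ x := fun x y hy =>
    h (show (x, y) ∈ setGraph Ψ from hy)
  refine h.antisymm ?_
  rintro ⟨x, y⟩ hy
  exact hΦ.2 (y := OrderDual.toDual Ψ) hΨ h' x hy

theorem IsUsco.exists_nhds_subset {Φ : X → Set Y} (hΦ : IsUsco Φ) {x : X} {V : Set Y}
    (hV : IsOpen V) (h : Φ x ⊆ V) : ∀ᶠ z in 𝓝 x, Φ z ⊆ V :=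
  (hΦ.2 V hV).mem_nhds h

theorem isUsco_of_eventually {Φ : X → Set Y} (h : ∀ x, (Φ x).Nonempty ∧ IsCompact (Φ x))
    (h' : ∀ V, IsOpen V → ∀ x, Φ x ⊆ V → ∀ᶠ z in 𝓝 x, Φ z ⊆ V) : IsUsco Φ :=
  ⟨h, fun V hV => isOpen_iff_mem_nhds.2 fun x hx => h' V hV x hx⟩

/-- An usco map can be replaced on an open set by a smaller one. -/
theorem IsUsco.ite {Φ Ψ : X → Set Y} (hΦ : IsUsco Φ) (hΨ : IsUsco Ψ) {V : Set X}
    [DecidablePred (· ∈ V)] (hV : IsOpen V) (h : ∀ x ∈ V, Φ x ⊆ Ψ x) :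
    IsUsco fun x => if x ∈ V then Φ x else Ψ x := by
  refine isUsco_of_eventually (fun x => ?_) fun G hG x hx => ?_
  · split_ifs
    exacts [hΦ.1 x, hΨ.1 x]
  · by_cases hxV : x ∈ V
    · rw [if_pos hxV] at hx
      filter_upwards [hΦ.exists_nhds_subset hG hx, hV.mem_nhds hxV] with z hz hzV
      rwa [if_pos hzV]
    · rw [if_neg hxV] at hx
      filter_upwards [hΨ.exists_nhds_subset hG hx] with z hz
      split_ifs with hzV
      exacts [(h z hzV).trans hz, hz]

/-- Minimality is local: cutting `Ψ` down to `Φ` on the open set `V` leaves an usco map. -/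
theorem IsMinimalUsco.eqOn_of_subset {Φ Ψ : X → Set Y} (hΨ : IsMinimalUsco Ψ) (hΦ : IsUsco Φ)
    {V : Set X} (hV : IsOpen V) (h : ∀ x ∈ V, Φ x ⊆ Ψ x) : ∀ x ∈ V, Φ x = Ψ x := by
  classical
  intro x hx
  have hsub : setGraph (fun x => if x ∈ V then Φ x else Ψ x) ⊆ setGraph Ψ := by
    rintro ⟨z, y⟩ hzy
    simp only [setGraph, mem_ofPred_eq] at hzy ⊢
    split_ifs at hzy with hz
    exacts [h z hz hzy, hzy]
  have heq := hΨ.2 _ (hΦ.ite hΨ.1 hV h) hsub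
  refine (h x hx).antisymm fun y hy => ?_
  have : (x, y) ∈ setGraph (fun x => if x ∈ V then Φ x else Ψ x) := heq.symm ▸ hy
  simpa [setGraph, hx] using this

/-- A minimal usco map can be modified to be constant off the closure of an open set. -/
theorem IsMinimalUsco.exists_modification [T2Space Y] {Ψ : X → Set Y} (hΨ : IsMinimalUsco Ψ)
    {V : Set X} (hV : IsOpen V) (c : Y) :
    ∃ Φ : X → Set Y, IsMinimalUsco Φ ∧ (∀ x ∈ V, Φ x = Ψ x) ∧ ∀ x ∉ closure V, Φ x = {c} := by
  -- This map is `Ψ` on `V`, `{c}` off `closure V`, and the union of both on the boundary, which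
  -- secures upper semicontinuity there. A minimal usco map below it must equal `Ψ` on `V` by local
  -- minimality.
  have hΘ : IsUsco fun x => {y | (x ∈ closure V ∧ y ∈ Ψ x) ∨ (x ∉ V ∧ y = c)} := by
    refine isUsco_of_eventually (fun x => ⟨?_, ?_⟩) fun G hG x hx => ?_
    · by_cases hx : x ∈ V
      · obtain ⟨y, hy⟩ := (hΨ.1.1 x).1
        exact ⟨y, Or.inl ⟨subset_closure hx, hy⟩⟩
      · exact ⟨c, Or.inr ⟨hx, rfl⟩⟩
    · have h1 : IsCompact {y | x ∈ closure V ∧ y ∈ Ψ x} := by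
        by_cases hx : x ∈ closure V
        · simpa [hx] using (hΨ.1.1 x).2
        · simp [hx]
      have h2 : IsCompact {y | x ∉ V ∧ y = c} := by
        by_cases hx : x ∈ V <;> simp [hx]
      exact h1.union h2
    · have h1 : ∀ᶠ z in 𝓝 x, z ∈ closure V → Ψ z ⊆ G := by
        by_cases hxV : x ∈ closure V
        · filter_upwards [hΨ.1.exists_nhds_subset hG fun y hy => hx (Or.inl ⟨hxV, hy⟩)]
            with z hz _ using hz
        · filter_upwards [isClosed_closure.isOpen_compl.mem_nhds hxV] with z hz hz'
          exact absurd hz' hz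
      have h2 : ∀ᶠ z in 𝓝 x, z ∉ V → c ∈ G := by
        by_cases hxV : x ∈ V
        · filter_upwards [hV.mem_nhds hxV] with z hz hz'
          exact absurd hz hz'
        · exact Eventually.of_forall fun z _ => hx (Or.inr ⟨hxV, rfl⟩)
      filter_upwards [h1, h2] with z hz1 hz2 y hy
      rcases hy with ⟨hz, hy⟩ | ⟨hz, rfl⟩
      exacts [hz1 hz hy, hz2 hz]
  obtain ⟨Φ, hΦ, hsub⟩ := hΘ.exists_isMinimalUsco
  refine ⟨Φ, hΦ, hΨ.eqOn_of_subset hΦ.1 hV fun x hx y hy => ?_, fun x hx => ?_⟩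
  · rcases hsub x hy with h | h
    exacts [h.2, absurd hx h.1]
  · refine (hΦ.1.1 x).1.subset_singleton_iff.1 fun y hy => ?_
    rcases hsub x hy with h | h
    exacts [absurd h.1 hx, h.2]

theorem IsUsco.exists_bound {Φ : X → Set ℝ} (hΦ : IsUsco Φ) {A : Set X} (hA : IsCompact A) :
    ∃ n : ℕ, ∀ x ∈ A, ∀ y ∈ Φ x, |y| < n := by
  obtain ⟨n, hn⟩ := hA.elim_directed_cover (fun n : ℕ => {x | Φ x ⊆ Metric.ball 0 n})
    (fun n => hΦ.2 _ Metric.isOpen_ball)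
    (fun x _ => by
      obtain ⟨r, hr⟩ := (hΦ.1 x).2.isBounded.subset_ball 0
      obtain ⟨n, hn⟩ := exists_nat_ge r
      exact mem_iUnion.2 ⟨n, hr.trans (Metric.ball_subset_ball hn)⟩)
    (directed_of_isDirected_le fun m n hmn x hx =>
      Subset.trans hx (Metric.ball_subset_ball (by exact_mod_cast hmn)))
  exact ⟨n, fun x hx y hy => by simpa using hn hx hy⟩

end UscoMaps

/-! ### The uniform topology on minimal usco maps -/

section MUTopology

variable {X : Type*} [TopologicalSpace X] {𝒜 : Set (Set X)}

theorem MU.entourage_mem_uniformity {A : Set X} (hA : A ∈ 𝒜) {ε : ℝ} (hε : 0 < ε) :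
    MU.entourage 𝒜 A ε ∈ uniformity (MU 𝒜) :=
  mem_iInf_of_mem A (mem_iInf_of_mem hA (mem_iInf_of_mem ε
    (mem_iInf_of_mem hε (mem_principal_self _))))

theorem MU.entourage_subset {A B : Set X} {ε δ : ℝ} (hAB : A ⊆ B) (h : δ ≤ ε) :
    MU.entourage 𝒜 B δ ⊆ MU.entourage 𝒜 A ε := fun _ hp x hx =>
  ⟨(hp x (hAB hx)).1.trans (iUnion₂_mono fun _ _ => Metric.ball_subset_ball h),
    (hp x (hAB hx)).2.trans (iUnion₂_mono fun _ _ => Metric.ball_subset_ball h)⟩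

/-- Closure of `𝒜` under unions makes the generating entourages a base: the supersets of entourages
already form a filter. -/
theorem MU.exists_entourage_subset (hne : 𝒜.Nonempty) (hU : ∀ A ∈ 𝒜, ∀ B ∈ 𝒜, A ∪ B ∈ 𝒜)
    {s : Set (MU 𝒜 × MU 𝒜)} (hs : s ∈ uniformity (MU 𝒜)) :
    ∃ A ∈ 𝒜, ∃ ε > 0, MU.entourage 𝒜 A ε ⊆ s := by
  let F : Filter (MU 𝒜 × MU 𝒜) :=
    { sets := {s | ∃ A ∈ 𝒜, ∃ ε > 0, MU.entourage 𝒜 A ε ⊆ s}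
      univ_sets := ⟨hne.some, hne.some_mem, 1, one_pos, subset_univ _⟩
      sets_of_superset := fun ⟨A, hA, ε, hε, h⟩ hst => ⟨A, hA, ε, hε, h.trans hst⟩
      inter_sets := fun ⟨A, hA, ε, hε, h⟩ ⟨B, hB, δ, hδ, h'⟩ =>
        ⟨A ∪ B, hU A hA B hB, min ε δ, lt_min hε hδ, subset_inter
          ((MU.entourage_subset subset_union_left (min_le_left _ _)).trans h)
          ((MU.entourage_subset subset_union_right (min_le_right _ _)).trans h')⟩ }
  have hF : F ≤ uniformity (MU 𝒜) := le_iInf₂ fun A hA => le_iInf₂ fun ε hε =>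
    le_principal_iff.2 ⟨A, hA, ε, hε, subset_rfl⟩
  exact hF hs

theorem MU.setOf_mem_nhds (Ψ : MU 𝒜) {A : Set X} (hA : A ∈ 𝒜) {ε : ℝ} (hε : 0 < ε) :
    {Φ | (Ψ, Φ) ∈ MU.entourage 𝒜 A ε} ∈ 𝓝 Ψ :=
  UniformSpace.ball_mem_nhds _ (MU.entourage_mem_uniformity hA hε)

theorem MU.exists_forall_mem_of_mem_nhds (hne : 𝒜.Nonempty) (hU : ∀ A ∈ 𝒜, ∀ B ∈ 𝒜, A ∪ B ∈ 𝒜)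
    {Ψ : MU 𝒜} {G : Set (MU 𝒜)} (hG : G ∈ 𝓝 Ψ) :
    ∃ A ∈ 𝒜, ∃ ε > 0, ∀ Φ, (Ψ, Φ) ∈ MU.entourage 𝒜 A ε → Φ ∈ G := by
  obtain ⟨V, hV, hVG⟩ := UniformSpace.mem_nhds_iff.1 hG
  obtain ⟨A, hA, ε, hε, h⟩ := MU.exists_entourage_subset hne hU hV
  exact ⟨A, hA, ε, hε, fun Φ hΦ => hVG (h hΦ)⟩

theorem MU.mem_entourage_of_eqOn {Ψ Φ : MU 𝒜} {A : Set X} {ε : ℝ} (hε : 0 < ε)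
    (h : ∀ x ∈ A, Φ.1 x = Ψ.1 x) : (Ψ, Φ) ∈ MU.entourage 𝒜 A ε := by
  have key : ∀ S : Set ℝ, S ⊆ ⋃ y ∈ S, Metric.ball y ε := fun S y hy =>
    mem_iUnion₂.2 ⟨y, hy, Metric.mem_ball_self hε⟩
  intro x hx
  dsimp only
  rw [h x hx]
  exact ⟨key _, key _⟩

theorem MU.zero_mem_entourage {Φ : MU 𝒜} {A : Set X} {ε : ℝ} :
    (MU.zero 𝒜, Φ) ∈ MU.entourage 𝒜 A ε ↔ ∀ x ∈ A, Φ.1 x ⊆ Metric.ball 0 ε := by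
  constructor
  · intro h x hx
    simpa [MU.zero] using (h x hx).2
  · intro h x hx
    have hx' := h x hx
    obtain ⟨y, hy⟩ := (Φ.2.1.1 x).1
    refine ⟨?_, by simpa [MU.zero] using hx'⟩
    rintro z (rfl : z = 0)
    exact mem_iUnion₂.2 ⟨y, hy, by simpa [abs_sub_comm] using hx' hy⟩

/-- Values are compact, hence closed, so a point of one value outside another is at positive
distance from it. -/
theorem MU.t1Space (h1 : ∀ x, {x} ∈ 𝒜) : T1Space (MU 𝒜) := by
  refine t1Space_iff_exists_open.2 fun Φ Ψ hne => ?_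
  have key : ∀ x, ∀ y, ∀ Φ Ψ : MU 𝒜, y ∈ Φ.1 x → y ∉ Ψ.1 x →
      ∃ ε > 0, (Φ, Ψ) ∉ MU.entourage 𝒜 {x} ε := by
    intro x y Φ Ψ hy hy'
    obtain ⟨ε, hε, h⟩ := Metric.isOpen_iff.1 (Ψ.2.1.1 x).2.isClosed.isOpen_compl y hy'
    refine ⟨ε, hε, fun hmem => ?_⟩
    obtain ⟨z, hz, hyz⟩ := mem_iUnion₂.1 ((hmem x rfl).1 hy)
    exact h (Metric.mem_ball_comm.1 hyz) hz
  suffices ∃ x, ∃ ε > 0, (Φ, Ψ) ∉ MU.entourage 𝒜 {x} ε by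
    obtain ⟨x, ε, hε, h⟩ := this
    obtain ⟨G, hG, hGo, hΦ⟩ := mem_nhds_iff.1 (MU.setOf_mem_nhds Φ (h1 x) hε)
    exact ⟨G, hGo, hΦ, fun hΨ => h (hG hΨ)⟩
  by_contra! hcon
  refine hne (Subtype.ext (funext fun x => Subset.antisymm ?_ ?_))
  · intro y hy
    by_contra hy'
    obtain ⟨ε, hε, h⟩ := key x y Φ Ψ hy hy'
    exact h (hcon x ε hε)
  · intro y hy
    by_contra hy'
    obtain ⟨ε, hε, h⟩ := key x y Ψ Φ hy hy'
    exact h fun z hz => ⟨(hcon x ε hε z hz).2, (hcon x ε hε z hz).1⟩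

end MUTopology

/-! ### Passing between covers of `X` and games on `MU 𝒜` -/

section Equivalence

variable {X : Type*} [TopologicalSpace X] {𝒜 : Set (Set X)}

theorem openNhds_nonempty [T1Space X] {A : Set X} (hne : A.Nonempty) (h : A ≠ univ) :
    (openNhds A).Nonempty := by
  obtain ⟨x, hx⟩ := (ne_univ_iff_exists_notMem A).1 h
  have hA : A ⊆ {x}ᶜ := subset_compl_singleton_iff.2 hx
  exact ⟨{x}ᶜ, ⟨isOpen_compl_singleton, hne.mono hA,
    fun h => (h.ge (mem_univ x) : x ∈ ({x}ᶜ : Set X)) rfl⟩, hA⟩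

theorem exists_isOpen_closure_subset_of_mem_openNhds [RegularSpace X] {A U : Set X}
    (hA : IsCompact A) (hU : U ∈ openNhds A) : ∃ V, IsOpen V ∧ A ⊆ V ∧ closure V ⊆ U :=
  hA.exists_isOpen_closure_subset (hU.1.1.mem_nhdsSet.2 hU.2)

theorem MU.exists_modification (Ψ : MU 𝒜) {V : Set X} (hV : IsOpen V) (c : ℝ) :
    ∃ Φ : MU 𝒜, (∀ x ∈ V, Φ.1 x = Ψ.1 x) ∧ ∀ x ∉ closure V, Φ.1 x = {c} := by
  obtain ⟨Φ, hΦ, h⟩ := Ψ.2.exists_modification hV c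
  exact ⟨⟨Φ, hΦ⟩, h⟩

/-- Since `𝟎` is not isolated, One may remove it from a neighbourhood and still have a legal open
move. -/
theorem MU.exists_ne_zero_mem [T3Space X] (hc : ∀ A ∈ 𝒜, IsCompact A ∧ A.Nonempty ∧ A ≠ univ)
    (hne : 𝒜.Nonempty) (hU : ∀ A ∈ 𝒜, ∀ B ∈ 𝒜, A ∪ B ∈ 𝒜) {G : Set (MU 𝒜)}
    (hG : G ∈ 𝓝 (MU.zero 𝒜)) : ∃ Φ ∈ G, Φ ≠ MU.zero 𝒜 := by
  obtain ⟨A, hA, ε, hε, h⟩ := MU.exists_forall_mem_of_mem_nhds hne hU hG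
  obtain ⟨U, hUA⟩ := openNhds_nonempty (hc A hA).2.1 (hc A hA).2.2
  obtain ⟨V, hV, hAV, hVU⟩ := exists_isOpen_closure_subset_of_mem_openNhds (hc A hA).1 hUA
  obtain ⟨x, hx⟩ := (ne_univ_iff_exists_notMem U).1 hUA.1.2.2
  obtain ⟨Φ, hΦ, hΦ'⟩ := MU.exists_modification (MU.zero 𝒜) hV 1
  refine ⟨Φ, h Φ (MU.mem_entourage_of_eqOn hε fun x hx => hΦ x (hAV hx)), ?_⟩
  rintro rfl
  have : ({0} : Set ℝ) = {1} := hΦ' x fun hxV => hx (hVU hxV)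
  exact zero_ne_one (singleton_injective this)

/-- If One can force Two to eventually cover each member of `𝒜`, then One can force convergence to
`𝟎` by restricting Two's choices to small neighbourhoods of `𝟎`. -/
theorem OneForces.tendsto_zero [T1Space X] {κ : Type*}
    (hc : ∀ A ∈ 𝒜, IsCompact A ∧ A.Nonempty ∧ A ≠ univ)
    (hne : 𝒜.Nonempty) (hU : ∀ A ∈ 𝒜, ∀ B ∈ 𝒜, A ∪ B ∈ 𝒜)
    (h : OneForces (fun A : 𝒜 => openNhds (A : Set X)) fun U => ∀ A ∈ 𝒜, ∀ᶠ n in atTop, A ⊆ U n)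
    {N : κ → Set (MU 𝒜)}
    (hN : ∀ A ∈ 𝒜, ∀ ε > 0, ∃ k, N k ⊆ {Φ | (MU.zero 𝒜, Φ) ∈ MU.entourage 𝒜 A ε}) :
    OneForces N fun Φ => Tendsto Φ atTop (𝓝 (MU.zero 𝒜)) := by
  classical
  choose f hf using fun (n : ℕ) (A : 𝒜) => hN A A.2 (1 / (n + 1 : ℝ)) Nat.one_div_pos_of_nat
  choose W hW using fun A : 𝒜 => openNhds_nonempty (hc A A.2).2.1 (hc A A.2).2.2
  let S : ℕ → MU 𝒜 → Set X := fun n Φ => {x | Φ.1 x ⊆ Metric.ball 0 (1 / (n + 1 : ℝ))}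
  -- The whole space is not a legal answer, so `W A` stands in for it; in that round the estimate
  -- holds on all of `X` anyway.
  refine h.transfer f (fun n A Φ => if S n Φ = univ then W A else S n Φ) ?_ ?_
  · intro n A Φ hΦ
    have hAS : (A : Set X) ⊆ S n Φ := MU.zero_mem_entourage.1 (hf n A hΦ)
    split_ifs with hS
    · exact hW A
    · exact ⟨⟨Φ.2.1.2 _ Metric.isOpen_ball, (hc A A.2).2.1.mono hAS, hS⟩, hAS⟩
  · intro i Φ hΦ hev G hG
    obtain ⟨A, hA, ε, hε, hAG⟩ := MU.exists_forall_mem_of_mem_nhds hne hU hG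
    change ∀ᶠ n in atTop, Φ n ∈ G
    filter_upwards [hev A hA, tendsto_one_div_add_atTop_nhds_zero_nat.eventually
      (gt_mem_nhds hε)] with n hn hnε
    refine hAG _ (MU.zero_mem_entourage.2 fun x hx => Subset.trans ?_
      (Metric.ball_subset_ball hnε.le))
    have hx' := hn hx
    by_cases hS : S n (Φ n) = univ
    · exact (hS ▸ mem_univ x : x ∈ S n (Φ n))
    · rwa [if_neg hS] at hx'

/-- A strategy of One in a game played on `MU_𝒜(X)` that prevents Two from escaping to infinity on
a member of `𝒜` yields a strategy forcing Two to cover each member of `𝒜`. -/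
theorem OneForces.forces_cover [T3Space X] {κ : Type*}
    (hc : ∀ A ∈ 𝒜, IsCompact A ∧ A.Nonempty ∧ A ≠ univ)
    (hne : 𝒜.Nonempty) (hU : ∀ A ∈ 𝒜, ∀ B ∈ 𝒜, A ∪ B ∈ 𝒜) {N : κ → Set (MU 𝒜)}
    (hN : ∀ k, IsOpen (N k) ∧ (N k).Nonempty)
    (h : OneForces N fun Φ => ∀ A ∈ 𝒜, ∃ n : ℕ, ∀ x ∈ A, (n + 1 : ℝ) ∉ (Φ n).1 x) :
    OneForces (fun A : 𝒜 => openNhds (A : Set X)) fun U => ∀ A ∈ 𝒜, ∃ n, A ⊆ U n := by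
  choose Ψ hΨ using fun k => (hN k).2
  choose A hA ε hε hAN using fun k =>
    MU.exists_forall_mem_of_mem_nhds hne hU ((hN k).1.mem_nhds (hΨ k))
  have key : ∀ (n : ℕ) (k : κ) (U : Set X), ∃ Φ : MU 𝒜, U ∈ openNhds (A k) →
      Φ ∈ N k ∧ ∀ x ∉ U, (n + 1 : ℝ) ∈ Φ.1 x := by
    intro n k U
    by_cases hUA : U ∈ openNhds (A k)
    · obtain ⟨V, hV, hAV, hVU⟩ := exists_isOpen_closure_subset_of_mem_openNhds (hc _ (hA k)).1 hUA
      obtain ⟨Φ, hΦ, hΦ'⟩ := MU.exists_modification (Ψ k) hV (n + 1 : ℝ)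
      refine ⟨Φ, fun _ => ⟨hAN k Φ (MU.mem_entourage_of_eqOn (hε k) fun x hx =>
        hΦ x (hAV hx)), fun x hx => ?_⟩⟩
      rw [hΦ' x fun hxV => hx (hVU hxV)]
      rfl
    · exact ⟨MU.zero 𝒜, fun h => absurd h hUA⟩
  choose g hg using key
  refine h.transfer (fun _ k => ⟨A k, hA k⟩) g (fun n k U hU => (hg n k U hU).1) ?_
  intro k U hUk hP B hB
  obtain ⟨n, hn⟩ := hP B hB
  refine ⟨n, fun x hx => ?_⟩
  by_contra hxU
  exact hn x hx ((hg n (k n) (U n) (hUk n)).2 x hxU)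

theorem exists_notMem_of_zero_mem_closure {Φ : ℕ → MU 𝒜}
    (h : MU.zero 𝒜 ∈ closure (range Φ)) {A : Set X} (hA : A ∈ 𝒜) :
    ∃ n : ℕ, ∀ x ∈ A, (n + 1 : ℝ) ∉ (Φ n).1 x := by
  obtain ⟨_, hΦ, n, rfl⟩ := mem_closure_iff_nhds.1 h _ (MU.setOf_mem_nhds _ hA one_pos)
  refine ⟨n, fun x hx hmem => ?_⟩
  have := MU.zero_mem_entourage.1 hΦ x hx hmem
  rw [mem_ball_zero_iff, Real.norm_eq_abs, abs_of_nonneg (by positivity)] at this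
  linarith [(Nat.cast_nonneg n : (0 : ℝ) ≤ n)]

theorem mem_closedDiscreteSets_of_forall {Z : Type*} [TopologicalSpace Z] {D : Set Z}
    (h : ∀ z, ∃ G ∈ 𝓝 z, G ∩ D ⊆ {z}) : D ∈ closedDiscreteSets Z := by
  refine ⟨isClosed_of_closure_subset fun z hz => ?_, ?_⟩
  · obtain ⟨G, hG, hGD⟩ := h z
    obtain ⟨y, hy⟩ := mem_closure_iff_nhds.1 hz G hG
    obtain rfl : y = z := hGD hy
    exact hy.2
  · refine discreteTopology_subtype_iff.2 fun z _ => ?_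
    obtain ⟨G, hG, hGD⟩ := h z
    refine disjoint_iff.1 (disjoint_principal_right.2 (mem_nhdsWithin.2 ?_))
    obtain ⟨O, hOG, hO, hz⟩ := mem_nhds_iff.1 hG
    exact ⟨O, hO, hz, fun y hy hyD => hy.2 (hGD ⟨hOG hy.1, hyD⟩)⟩

/-- Otherwise each `Φ n` takes the value `n + 1` on `A`. Any `Ψ` is bounded by some `m` on `A`, so
only maps with `n < m + 1` can be within `1` of it there; these are finitely many, and the T1
property separates `Ψ` from those different from it. -/
theorem exists_notMem_of_notMem_closedDiscreteSets (h1 : ∀ x, {x} ∈ 𝒜)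
    {Φ : ℕ → MU 𝒜} (h : range Φ ∉ closedDiscreteSets (MU 𝒜)) {A : Set X} (hA : A ∈ 𝒜)
    (hc : IsCompact A) : ∃ n : ℕ, ∀ x ∈ A, (n + 1 : ℝ) ∉ (Φ n).1 x := by
  have := MU.t1Space h1
  by_contra! hcon
  refine h (mem_closedDiscreteSets_of_forall fun Ψ => ?_)
  obtain ⟨m, hm⟩ := Ψ.2.1.exists_bound hc
  have hfin : ((Φ '' Iio (m + 1)) \ {Ψ}).Finite := ((finite_Iio _).image Φ).sdiff
  refine ⟨_, inter_mem (MU.setOf_mem_nhds Ψ hA one_pos)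
    (hfin.isClosed.isOpen_compl.mem_nhds fun h => h.2 rfl), ?_⟩
  rintro _ ⟨⟨hΨ, hn⟩, n, rfl⟩
  by_contra hne
  refine hn ⟨⟨n, ?_, rfl⟩, hne⟩
  obtain ⟨x, hx, hmem⟩ := hcon n
  obtain ⟨y, hy, hny⟩ := mem_iUnion₂.1 ((hΨ x hx).2 hmem)
  have h2 := (abs_lt.1 (hm x hx y hy)).2
  rw [Metric.mem_ball, Real.dist_eq] at hny
  have h3 := (abs_lt.1 hny).2
  have : (n : ℝ) < m + 1 := by linarith
  exact mem_Iio.2 (by exact_mod_cast this)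

theorem tfae_games [T3Space X] [Nonempty X] (h1 : ∀ x, {x} ∈ 𝒜)
    (hU : ∀ A ∈ 𝒜, ∀ B ∈ 𝒜, A ∪ B ∈ 𝒜)
    (hc : ∀ A ∈ 𝒜, IsCompact A ∧ A.Nonempty ∧ A ≠ univ) :
    List.TFAE [
      TwoWins (idealCovers 𝒜) (idealCovers 𝒜),
      TwoWins (clusterSets (MU.zero 𝒜)) (clusterSets (MU.zero 𝒜)),
      TwoWins (denseSets (MU 𝒜)) (clusterSets (MU.zero 𝒜)),
      OneWins (properOpens (MU 𝒜)) (closedDiscreteSets (MU 𝒜)),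
      OneWins (openNhdsFamilies 𝒜) (idealCovers 𝒜)ᶜ,
      OneWins (openNhdsFamilies 𝒜) (gammaCovers 𝒜)ᶜ] := by
  have hne : 𝒜.Nonempty := ⟨_, h1 (Classical.arbitrary X)⟩
  have hT1 := MU.t1Space h1
  have hcover : ∀ c : 𝒜 → Set X, (∀ A : 𝒜, c A ∈ openNhds (A : Set X)) →
      range c ∈ idealCovers 𝒜 := fun c hcA =>
    range_mem_idealCovers h1 (fun A => (hcA A).1) fun A hA => ⟨⟨A, hA⟩, (hcA ⟨A, hA⟩).2⟩
  let Cov : Prop := OneForces (fun A : 𝒜 => openNhds (A : Set X))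
    fun U => ∀ A ∈ 𝒜, ∃ n, A ⊆ U n
  let Ev : Prop := OneForces (fun A : 𝒜 => openNhds (A : Set X))
    fun U => ∀ A ∈ 𝒜, ∀ᶠ n in atTop, A ⊆ U n
  have hCovEv : Cov → Ev := OneForces.eventually_subset hU
  have hrange : ∀ U : ℕ → Set X, range U ∈ idealCovers 𝒜 → ∀ A ∈ 𝒜, ∃ n, A ⊆ U n := by
    intro U hUc A hA
    obtain ⟨_, ⟨n, rfl⟩, hn⟩ := hUc.2 A hA
    exact ⟨n, hn⟩
  have h1Cov : TwoWins (idealCovers 𝒜) (idealCovers 𝒜) → Cov := fun h =>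
    (h.oneForces hcover).mono fun U _ => hrange U
  have hCov1 : Cov → TwoWins (idealCovers 𝒜) (idealCovers 𝒜) := by
    intro h
    choose c hcA using fun A : 𝒜 => openNhds_nonempty (hc A A.2).2.1 (hc A A.2).2.2
    refine (h.mono fun U hUm hUc => range_mem_idealCovers h1
      (fun n => ?_) hUc).twoWins ?_ ?_
    · obtain ⟨A, hA⟩ := hUm n
      exact hA.1
    · obtain ⟨A, hA⟩ := hne
      exact ⟨c ⟨A, hA⟩, range c, hcover c hcA, mem_range_self _⟩
    · rintro A 𝒰 h𝒰
      obtain ⟨U, hU𝒰, hAU⟩ := h𝒰.2 A A.2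
      exact ⟨U, ⟨⟨h𝒰.1.1 U hU𝒰, (hc A A.2).2.1.mono hAU, fun h => h𝒰.1.2.2.2 (h ▸ hU𝒰)⟩, hAU⟩,
        hU𝒰⟩
  have hEv6 : Ev → OneWins (openNhdsFamilies 𝒜) (gammaCovers 𝒜)ᶜ := by
    intro h
    refine h.oneWins (fun A => ⟨A, A.2, rfl⟩) fun U hUm hUev => not_not.2 ⟨?_, ?_, ?_⟩
    · refine range_mem_idealCovers h1 (fun n => ?_) fun A hA => (hUev A hA).exists
      obtain ⟨A, hA⟩ := hUm n
      exact hA.1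
    · exact countable_range U
    · intro A hA
      obtain ⟨n, hn⟩ := eventually_atTop.1 (hUev A hA)
      refine ((finite_Iio n).image U).subset ?_
      rintro _ ⟨⟨m, rfl⟩, hm⟩
      exact ⟨m, not_le.1 fun hnm => hm (hn m hnm), rfl⟩
  have h65 : OneWins (openNhdsFamilies 𝒜) (gammaCovers 𝒜)ᶜ →
      OneWins (openNhdsFamilies 𝒜) (idealCovers 𝒜)ᶜ := by
    rintro ⟨σ, hσ⟩
    exact ⟨σ, fun x hx => not_not.2 (not_not.1 (hσ x hx)).1⟩
  have h5Cov : OneWins (openNhdsFamilies 𝒜) (idealCovers 𝒜)ᶜ → Cov := by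
    intro h
    choose B hB hBeq using fun 𝒰 : openNhdsFamilies 𝒜 => 𝒰.2
    refine h.oneForces.transfer (fun _ 𝒰 => ⟨B 𝒰, hB 𝒰⟩) (fun _ _ U => U)
      (fun n 𝒰 U hU => ?_) fun _ U _ hUc => hrange U (not_not.1 hUc)
    dsimp only at hU ⊢
    rwa [← hBeq 𝒰]
  have hEv2 : Ev → TwoWins (clusterSets (MU.zero 𝒜)) (clusterSets (MU.zero 𝒜)) := by
    intro h
    have h' : OneForces (fun G : {G // G ∈ 𝓝 (MU.zero 𝒜)} => (G : Set (MU 𝒜)))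
        fun Φ => Tendsto Φ atTop (𝓝 (MU.zero 𝒜)) :=
      OneForces.tendsto_zero hc hne hU h
        fun A hA ε hε => ⟨⟨_, MU.setOf_mem_nhds _ hA hε⟩, subset_rfl⟩
    refine (h'.mono fun Φ _ hΦ => ?_).twoWins ?_ fun G D hD =>
      mem_closure_iff_nhds.1 hD G G.2
    · exact mem_closure_of_tendsto hΦ (Eventually.of_forall fun n => ⟨n, rfl⟩)
    · exact ⟨MU.zero 𝒜, {MU.zero 𝒜}, subset_closure rfl, rfl⟩
  have h23 : TwoWins (clusterSets (MU.zero 𝒜)) (clusterSets (MU.zero 𝒜)) →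
      TwoWins (denseSets (MU 𝒜)) (clusterSets (MU.zero 𝒜)) := by
    rintro ⟨τ, hτ⟩
    refine ⟨fun l => ⟨τ (l.map fun D : denseSets (MU 𝒜) => ⟨D.1, D.2 _⟩), univ,
      dense_univ, trivial⟩, fun A => ?_⟩
    simp only [List.map_map]
    exact hτ fun n => ⟨(A n).1, (A n).2 _⟩
  have h3Cov : TwoWins (denseSets (MU 𝒜)) (clusterSets (MU.zero 𝒜)) → Cov := by
    intro h
    have h' := h.oneForces (M := fun G : {G : Set (MU 𝒜) // IsOpen G ∧ G.Nonempty} => G.1)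
      fun c hcG => by
        refine dense_iff_inter_open.2 fun G hG hGne => ?_
        exact ⟨_, hcG ⟨G, hG, hGne⟩, ⟨_, rfl⟩⟩
    exact OneForces.forces_cover hc hne hU (fun G => G.2)
      (h'.mono fun Φ _ hΦ A hA => exists_notMem_of_zero_mem_closure hΦ hA)
  have hEv4 : Ev → OneWins (properOpens (MU 𝒜)) (closedDiscreteSets (MU 𝒜)) := by
    intro h
    -- One's moves omit `𝟎`, so Two's answers converge to a point outside their range, which is
    -- therefore not closed.
    have h' : OneForces (fun G : {G // G ∈ properOpens (MU 𝒜) ∧ MU.zero 𝒜 ∉ G} => G.1)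
        fun Φ => Tendsto Φ atTop (𝓝 (MU.zero 𝒜)) := by
      refine OneForces.tendsto_zero hc hne hU h fun A hA ε hε => ?_
      obtain ⟨G, hG, hGo, h0⟩ := mem_nhds_iff.1 (MU.setOf_mem_nhds (MU.zero 𝒜) hA hε)
      obtain ⟨Φ, hΦ, hΦ0⟩ := MU.exists_ne_zero_mem hc hne hU (hGo.mem_nhds h0)
      refine ⟨⟨G \ {MU.zero 𝒜}, ⟨hGo.sdiff isClosed_singleton, ⟨Φ, hΦ, hΦ0⟩, fun h => ?_⟩,
        fun h => h.2 rfl⟩, sdiff_subset.trans hG⟩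
      exact (h ▸ mem_univ (MU.zero 𝒜) : MU.zero 𝒜 ∈ G \ {MU.zero 𝒜}).2 rfl
    refine h'.oneWins (fun G => G.2.1) fun Φ hΦm hΦ hcd => ?_
    obtain ⟨n, hn⟩ : MU.zero 𝒜 ∈ range Φ := hcd.1.closure_subset
      (mem_closure_of_tendsto hΦ (Eventually.of_forall fun n => ⟨n, rfl⟩))
    obtain ⟨⟨G, hGp, h0⟩, hG⟩ := hΦm n
    exact h0 (hn ▸ hG)
  have h4Cov : OneWins (properOpens (MU 𝒜)) (closedDiscreteSets (MU 𝒜)) → Cov := fun h =>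
    OneForces.forces_cover hc hne hU (fun G => ⟨G.2.1, G.2.2.1⟩)
      (h.oneForces.mono fun Φ _ hΦ A hA =>
        exists_notMem_of_notMem_closedDiscreteSets h1 hΦ hA (hc A hA).1)
  tfae_have 1 → 2 := fun h => hEv2 (hCovEv (h1Cov h))
  tfae_have 2 → 3 := h23
  tfae_have 3 → 4 := fun h => hEv4 (hCovEv (h3Cov h))
  tfae_have 4 → 6 := fun h => hEv6 (hCovEv (h4Cov h))
  tfae_have 6 → 5 := h65
  tfae_have 5 → 1 := fun h => hCov1 (h5Cov h)
  tfae_finish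

end Equivalence

end UscoGame

theorem corollary3p13 (X : Type*) [TopologicalSpace X] [T3Space X] :
    (Infinite X → List.TFAE [
      TwoWins (idealCovers (finiteIdeal X)) (idealCovers (finiteIdeal X)),
      TwoWins (clusterSets (MU.zero (finiteIdeal X))) (clusterSets (MU.zero (finiteIdeal X))),
      TwoWins (denseSets (MUp X)) (clusterSets (MU.zero (finiteIdeal X))),
      OneWins (properOpens (MUp X)) (closedDiscreteSets (MUp X)),
      OneWins (openNhdsFamilies (finiteIdeal X)) (idealCovers (finiteIdeal X))ᶜ,
      OneWins (openNhdsFamilies (finiteIdeal X)) (gammaCovers (finiteIdeal X))ᶜ]) ∧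
    (NoncompactSpace X → List.TFAE [
      TwoWins (idealCovers (compactIdeal X)) (idealCovers (compactIdeal X)),
      TwoWins (clusterSets (MU.zero (compactIdeal X))) (clusterSets (MU.zero (compactIdeal X))),
      TwoWins (denseSets (MUk X)) (clusterSets (MU.zero (compactIdeal X))),
      OneWins (properOpens (MUk X)) (closedDiscreteSets (MUk X)),
      OneWins (openNhdsFamilies (compactIdeal X)) (idealCovers (compactIdeal X))ᶜ,
      OneWins (openNhdsFamilies (compactIdeal X)) (gammaCovers (compactIdeal X))ᶜ]) := by
  constructor
  · intro hX
    exact tfae_games (fun x => ⟨finite_singleton x, singleton_nonempty x⟩)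
      (fun A hA B hB => ⟨hA.1.union hB.1, hA.2.inl⟩)
      fun A hA => ⟨hA.1.isCompact, hA.2, fun h => infinite_univ (h ▸ hA.1)⟩
  · intro hX
    have : Nonempty X := by
      by_contra h
      exact hX.noncompact_univ (by simp [univ_eq_empty_iff.2 (not_nonempty_iff.1 h)])
    exact tfae_games (fun x => ⟨isCompact_singleton, singleton_nonempty x⟩)
      (fun A hA B hB => ⟨hA.1.union hB.1, hA.2.inl⟩)
      fun A hA => ⟨hA.1, hA.2, fun h => hX.noncompact_univ (h ▸ hA.1)⟩
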